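/- Let $l \ge 1$ and let $q_i^- \le q_i^+$ be real numbers for $i = 1, \dots, l$. Let $$Q = \{ q \in \mathbb{R}^l : q_i \in [q_i^-, q_i^+] \text{ for all } i \}$$ be the corresponding box, and let $$Q_E = \{ q \in \mathbb{R}^l : \text{for some } k,\ q_k \in [q_k^-, q_k^+] \text{ and } q_i \in \{q_i^-, q_i^+\} \text{ for all } i \neq k \}$$ be its one-dimensional edge set. Let $$n(s,q) = \sum_{i=0}^{n_1} c_i(q) s^i, \qquad d(s,q) = \sum_{j=0}^{n_2} b_j(q) s^j,$$ where the complex coefficients $c_i(q)$, $b_j(q)$ are affine functions of the real parameter vector $q$, let $m \ge 0$ and $a_0, \dots, a_m \in \mathbb{C}$, and put $$g(s,q) = \sum_{k=0}^{m} a_k\, n(s,q)^k\, d(s,q)^{m-k}.$$ Let $D \subseteq \mathbb{C}$ be a set whose complement $D^c = \mathbb{C} \setminus D$ is connected and is either unbounded or empty. A polynomial in $s$ is called $D$-stable if all its complex roots lie in $D$. Suppose that the polynomials $g(\cdot,q)$, $q \in Q$, all have the same degree in $s$ (where the zero polynomial has degree $-\infty$). Then $g(\cdot,q)$ is $D$-stable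 for every $q \in Q$ if and only if $g(\cdot,q)$ is $D$-stable for every $q \in Q_E$. -/

import Mathlib

/-- The hyperbox `Q`: all parameter vectors `q` with `lo i ≤ q i ≤ hi i` for every `i`. -/
def paramBox {l : ℕ} (lo hi : Fin l → ℝ) : Set (Fin l → ℝ) :=
  {q | ∀ i, q i ∈ Set.Icc (lo i) (hi i)}

/-- The one-dimensional edge set `Q_E`: for some `k` the coordinate `q k` runs through its
interval, and every other coordinate is an end point of its interval. -/
def edgeSet {l : ℕ} (lo hi : Fin l → ℝ) : Set (Fin l → ℝ) :=
  {q | ∃ k, q k ∈ Set.Icc (lo k) (hi k) ∧ ∀ i, i ≠ k → q i = lo i ∨ q i = hi i}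

/-- The polynomial `∑_{i = 0}^{N} c_i(q) s^i` in `s`, whose complex coefficients are (real-)affine
functions of the parameter vector `q`. -/
noncomputable def affinePoly {l : ℕ} (N : ℕ) (c : Fin (N + 1) → ((Fin l → ℝ) →ᵃ[ℝ] ℂ))
    (q : Fin l → ℝ) : Polynomial ℂ :=
  ∑ i : Fin (N + 1), Polynomial.C (c i q) * Polynomial.X ^ (i : ℕ)

/-- The form `∑_{k = 0}^{m} a_k n^k d^{m - k}` evaluated at two polynomials. -/
noncomputable def homogComb (m : ℕ) (a : Fin (m + 1) → ℂ) (n d : Polynomial ℂ) : Polynomial ℂ :=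
  ∑ k : Fin (m + 1), Polynomial.C (a k) * n ^ (k : ℕ) * d ^ (m - (k : ℕ))

/-- A polynomial family has a fixed order: all its members have the same degree
(the zero polynomial has degree `⊥`, so it is never confused with a nonzero constant). -/
def HasFixedOrder (P : Set (Polynomial ℂ)) : Prop :=
  ∀ p₁ ∈ P, ∀ p₂ ∈ P, p₁.degree = p₂.degree

/-- A polynomial is `D`-stable: all its roots lie in `D`. -/
def IsDStable (D : Set ℂ) (p : Polynomial ℂ) : Prop :=
  ∀ z : ℂ, p.IsRoot z → z ∈ D

/-- A polynomial family is `D`-stable: all its members are. -/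
def FamilyDStable (D : Set ℂ) (P : Set (Polynomial ℂ)) : Prop :=
  ∀ p ∈ P, IsDStable D p

open Polynomial Set Filter Topology

/-! Let `g(·,q₀)` have a root `s₀` outside `D`. Over `ℂ` a linear form `ux + vy` vanishes at
`(n(s₀,q₀), d(s₀,q₀))` and only at zeros of the binary form (`exists_linear_factor`), so `F(s,q) = u
n + v d` is affine in `q` and its zeros are zeros of `g`. Let `Z` be the set of `s` with `0 ∈
F(s,Q)`. Fixed degree makes `Z` bounded, so the connected unbounded set `Dᶜ` meets `Z` and its
complement, hence the frontier of `Z`. Off `Z`, a line through `0` bounds a half-plane containing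
the convex set `F(s,Q)`; in the limit, at a frontier point such a line supports `F(s,Q)` at `0`. An
extreme point of the fibre over `0` then lies on an edge (`exists_edgeSet_eq_zero_of_support`),
giving an edge polynomial with a root outside `D`. -/

theorem edgeSet_subset_paramBox {l : ℕ} {lo hi : Fin l → ℝ} (h : ∀ i, lo i ≤ hi i) :
    edgeSet lo hi ⊆ paramBox lo hi := by
  rintro q ⟨k, hk, hq⟩ i
  by_cases hik : i = k
  · exact hik ▸ hk
  · rcases hq i hik with e | e <;> rw [e]
    exacts [⟨le_rfl, h i⟩, ⟨h i, le_rfl⟩]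

theorem paramBox_eq_Icc {l : ℕ} (lo hi : Fin l → ℝ) : paramBox lo hi = Set.Icc lo hi := by
  ext q
  simp only [paramBox, Set.mem_ofPred_eq, Set.mem_Icc, Pi.le_def]
  exact forall_and

theorem isCompact_paramBox {l : ℕ} (lo hi : Fin l → ℝ) : IsCompact (paramBox lo hi) :=
  paramBox_eq_Icc lo hi ▸ isCompact_Icc

theorem convex_paramBox {l : ℕ} (lo hi : Fin l → ℝ) : Convex ℝ (paramBox lo hi) :=
  paramBox_eq_Icc lo hi ▸ convex_Icc _ _

theorem add_single_mem_paramBox {l : ℕ} {lo hi q : Fin l → ℝ} (hq : q ∈ paramBox lo hi)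
    {i : Fin l} {t : ℝ} (ht : q i + t ∈ Set.Icc (lo i) (hi i)) :
    q + Pi.single i t ∈ paramBox lo hi := by
  intro j
  by_cases hj : j = i
  · subst hj; simpa using ht
  · simpa [hj] using hq j

/-! ### Supporting lines of affine images of a box -/

/-- Two complex numbers annihilated by a nonzero real functional are linearly dependent. -/
theorem exists_real_combination_eq_zero {w x y : ℂ} (hw : w ≠ 0)
    (hx : (star w * x).re = 0) (hy : (star w * y).re = 0) :
    ∃ α β : ℝ, (α ≠ 0 ∨ β ≠ 0) ∧ α • x + β • y = 0 := by
  have hw' : star w ≠ 0 := star_ne_zero.mpr hw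
  have key : ∀ z : ℂ, (star w * z).re = 0 → star w * z = ((star w * z).im : ℂ) * Complex.I := by
    intro z hz
    apply Complex.ext <;> simp
    simpa using hz
  by_cases h : (star w * x).im = 0
  · refine ⟨1, 0, Or.inl one_ne_zero, ?_⟩
    have := key x hx
    rw [h] at this
    simp only [Complex.ofReal_zero, zero_mul, mul_eq_zero, hw', false_or] at this
    simp [this]
  · refine ⟨(star w * y).im, -(star w * x).im, Or.inr (neg_ne_zero.mpr h), ?_⟩
    apply mul_left_cancel₀ hw'
    rw [mul_add, mul_smul_comm, mul_smul_comm, key x hx, key y hy]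
    simp only [Complex.real_smul, mul_zero, Complex.ofReal_neg]
    generalize (star w * y).im = A
    generalize (star w * x).im = B
    simp
    ring

/-- If the image of a box under an affine map to the plane has a supporting line at `0`, then
some point of the edge set is mapped to `0`. -/
theorem exists_edgeSet_eq_zero_of_support {l : ℕ} (hl : 0 < l) {lo hi : Fin l → ℝ}
    (F : (Fin l → ℝ) →ᵃ[ℝ] ℂ) {w : ℂ} (hw : w ≠ 0)
    (hsupp : ∀ q ∈ paramBox lo hi, 0 ≤ (star w * F q).re)
    (hzero : ∃ q ∈ paramBox lo hi, F q = 0) : ∃ q ∈ edgeSet lo hi, F q = 0 := by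
  have hcont : Continuous F := AffineMap.continuous_of_finiteDimensional F
  have hK : IsCompact (paramBox lo hi ∩ F ⁻¹' {0}) :=
    (isCompact_paramBox lo hi).inter_right (isClosed_singleton.preimage hcont)
  obtain ⟨q, hq⟩ := hK.extremePoints_nonempty (by
    obtain ⟨q, h1, h2⟩ := hzero
    exact ⟨q, h1, h2⟩)
  obtain ⟨⟨hqQ, hqF⟩, hext⟩ := mem_extremePoints.mp hq
  rw [Set.mem_preimage, Set.mem_singleton_iff] at hqF
  have hadd : ∀ x, F (q + x) = F.linear x := fun x => by
    have := F.map_vadd q x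
    simp only [vadd_eq_add, hqF, add_zero] at this
    rw [add_comm, this]
  have hsingle : ∀ i t, F.linear (Pi.single i t) = t • F.linear (Pi.single i 1) := fun i t => by
    rw [← map_smul, ← Pi.single_smul, smul_eq_mul, mul_one]
  -- room to move in a coordinate that is not an end point
  have hroom : ∀ i, ¬ (q i = lo i ∨ q i = hi i) →
      ∃ ε > 0, ∀ t, |t| ≤ ε → q i + t ∈ Set.Icc (lo i) (hi i) := fun i hi' => by
    push Not at hi'
    have h1 := lt_of_le_of_ne (hqQ i).1 hi'.1.symm
    have h2 := lt_of_le_of_ne (hqQ i).2 hi'.2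
    refine ⟨min (q i - lo i) (hi i - q i), lt_min (by linarith) (by linarith), fun t ht => ?_⟩
    have h3 := abs_le.mp (ht.trans (min_le_left _ _))
    have h4 := abs_le.mp (ht.trans (min_le_right _ _))
    exact ⟨by linarith, by linarith⟩
  -- A free coordinate moves both ways, so its image direction must lie in the supporting line.
  have hann : ∀ i, ¬ (q i = lo i ∨ q i = hi i) →
      (star w * F.linear (Pi.single i 1)).re = 0 := fun i hi' => by
    obtain ⟨ε, hε, hr⟩ := hroom i hi'
    have key : ∀ t, |t| ≤ ε → 0 ≤ t * (star w * F.linear (Pi.single i 1)).re := fun t ht => by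
      have := hsupp _ (add_single_mem_paramBox hqQ (hr t ht))
      rwa [hadd, hsingle, mul_smul_comm, Complex.smul_re, smul_eq_mul] at this
    have h1 := key ε (abs_of_pos hε).le
    have h2 := key (-ε) (by rw [abs_neg, abs_of_pos hε])
    have h3 := nonneg_of_mul_nonneg_right h1 hε
    have h4 : 0 ≤ -(star w * F.linear (Pi.single i 1)).re :=
      nonneg_of_mul_nonneg_right (by linarith) hε
    linarith
  have huniq : ∀ i j, i ≠ j → ¬ (q i = lo i ∨ q i = hi i) → (q j = lo j ∨ q j = hi j) := by
    intro i j hij hi'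
    by_contra hj'
    obtain ⟨α, β, hne, hαβ⟩ := exists_real_combination_eq_zero hw (hann i hi') (hann j hj')
    obtain ⟨ε, hε, hr⟩ := hroom i hi'
    obtain ⟨δ, hδ, hs⟩ := hroom j hj'
    obtain ⟨r, hr0, hrα, hrβ⟩ : ∃ r > 0, r * |α| ≤ ε ∧ r * |β| ≤ δ := by
      refine ⟨min ε δ / (|α| + |β| + 1), by positivity, ?_, ?_⟩ <;>
        rw [div_mul_eq_mul_div, div_le_iff₀ (by positivity)]
      · nlinarith [min_le_left ε δ, lt_min hε hδ, abs_nonneg α, abs_nonneg β]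
      · nlinarith [min_le_right ε δ, lt_min hε hδ, abs_nonneg α, abs_nonneg β]
    have hmem : ∀ t : ℝ, |t| = r → q + (Pi.single i (t * α) + Pi.single j (t * β)) ∈
        paramBox lo hi ∩ F ⁻¹' {0} := by
      intro t ht
      constructor
      · rw [← add_assoc]
        refine add_single_mem_paramBox (add_single_mem_paramBox hqQ (hr _ ?_)) ?_
        · rwa [abs_mul, ht]
        · rw [Pi.add_apply, Pi.single_eq_of_ne hij.symm, add_zero]
          exact hs _ (by rwa [abs_mul, ht])
      · rw [Set.mem_preimage, Set.mem_singleton_iff, hadd, map_add, hsingle i, hsingle j,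
          mul_smul, mul_smul, ← smul_add, hαβ, smul_zero]
    have h1 := hmem r (abs_of_pos hr0)
    have h2 := hmem (-r) (by rw [abs_neg, abs_of_pos hr0])
    have hseg : q ∈ openSegment ℝ (q + (Pi.single i (r * α) + Pi.single j (r * β)))
        (q + (Pi.single i (-r * α) + Pi.single j (-r * β))) := by
      refine ⟨1 / 2, 1 / 2, by norm_num, by norm_num, by norm_num, ?_⟩
      rw [neg_mul, neg_mul, Pi.single_neg, Pi.single_neg]
      module
    have h3 := (hext _ h1 _ h2 hseg).1
    rw [add_eq_left] at h3
    have hi0 := congrFun h3 i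
    have hj0 := congrFun h3 j
    simp only [Pi.add_apply, Pi.single_eq_same, Pi.single_eq_of_ne hij, add_zero, Pi.zero_apply,
      mul_eq_zero, hr0.ne', false_or] at hi0
    simp only [Pi.add_apply, Pi.single_eq_same, Pi.single_eq_of_ne hij.symm, zero_add,
      Pi.zero_apply, mul_eq_zero, hr0.ne', false_or] at hj0
    exact hne.elim (· hi0) (· hj0)
  refine ⟨q, ?_, hqF⟩
  by_cases h : ∃ k, ¬ (q k = lo k ∨ q k = hi k)
  · obtain ⟨k, hk⟩ := h
    exact ⟨k, hqQ k, fun i hik => huniq k i hik.symm hk⟩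
  · push Not at h
    exact ⟨⟨0, hl⟩, hqQ _, fun i _ => or_iff_not_imp_left.mpr (by simpa [or_iff_not_imp_left] using h i)⟩

/-- A compact convex set in the plane that avoids `0` lies in a half-plane bounded by a line
through `0`. -/
theorem exists_unit_support_of_zero_notMem {K : Set ℂ} (hc : Convex ℝ K) (hK : IsCompact K)
    (h0 : (0 : ℂ) ∉ K) : ∃ w ∈ Metric.sphere (0 : ℂ) 1, ∀ z ∈ K, 0 ≤ (star w * z).re := by
  obtain ⟨f, u, hfu, hu⟩ := geometric_hahn_banach_point_closed hc hK.isClosed h0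
  rw [map_zero] at hfu
  -- For empty `K` the separating functional may be zero and cannot be normalised.
  rcases K.eq_empty_or_nonempty with rfl | ⟨z₀, hz₀⟩
  · exact ⟨1, by simp, by simp⟩
  set v : ℂ := ⟨f 1, f Complex.I⟩ with hv
  have hf : ∀ z, f z = (star v * z).re := fun z => by
    have : z = z.re • (1 : ℂ) + z.im • Complex.I := by simp
    conv_lhs => rw [this]
    rw [map_add, map_smul, map_smul]
    simp [hv, Complex.mul_re]
    ring
  have hv0 : v ≠ 0 := fun h => by
    have := hu z₀ hz₀
    rw [hf, h] at this
    simp at this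
    linarith
  refine ⟨(‖v‖⁻¹ : ℝ) • v, ?_, fun z hz => ?_⟩
  · rw [mem_sphere_zero_iff_norm, norm_smul, norm_inv, norm_norm,
      inv_mul_cancel₀ (norm_ne_zero_iff.mpr hv0)]
  · have h1 := hu z hz
    rw [hf] at h1
    rw [star_smul, smul_mul_assoc, Complex.smul_re, smul_eq_mul]
    exact mul_nonneg (by simp) (hfu.trans h1).le

/-! ### Frontier of the zero set -/

/-- The set of `s` at which a member of a family over a compact set vanishes is closed. -/
theorem isClosed_setOf_exists_eq_zero {X Y : Type*} [TopologicalSpace X] [TopologicalSpace Y]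
    {Q : Set Y} (hQ : IsCompact Q) {f : X → Y → ℂ} (hf : Continuous (Function.uncurry f)) :
    IsClosed {s | ∃ q ∈ Q, f s q = 0} := by
  have : CompactSpace Q := isCompact_iff_compactSpace.mp hQ
  have h : IsClosed {x : X × Q | f x.1 x.2 = 0} :=
    isClosed_eq (hf.comp (continuous_fst.prodMk (continuous_subtype_val.comp continuous_snd)))
      continuous_const
  convert isClosedMap_fst_of_compactSpace _ h using 1
  ext s
  simp

/-- A family of affine maps on a box vanishes on the edge set at every frontier point of the
set of parameters where it vanishes on the box. -/
theorem exists_edgeSet_eq_zero_of_mem_frontier {l : ℕ} (hl : 0 < l) {lo hi : Fin l → ℝ}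
    {F : ℂ → (Fin l → ℝ) →ᵃ[ℝ] ℂ} (hF : Continuous (Function.uncurry fun s q => F s q)) {s : ℂ}
    (hs : s ∈ frontier {s | ∃ q ∈ paramBox lo hi, F s q = 0}) :
    ∃ q ∈ edgeSet lo hi, F s q = 0 := by
  have hcl := isClosed_setOf_exists_eq_zero (isCompact_paramBox lo hi) hF
  have hsZ := hcl.frontier_subset hs
  have hFq : ∀ q, Continuous fun s => F s q := fun q => hF.comp (continuous_id.prodMk continuous_const)
  -- Unit normals range over a compact set, so supporting lines survive limits in `s`.
  have hsupp : IsClosed {s | ∃ w ∈ Metric.sphere (0 : ℂ) 1,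
      ∀ q ∈ paramBox lo hi, 0 ≤ (star w * F s q).re} := by
    have h : IsClosed {x : ℂ × Metric.sphere (0 : ℂ) 1 |
        ∀ q ∈ paramBox lo hi, 0 ≤ (star (x.2 : ℂ) * F x.1 q).re} := by
      simp only [Set.ofPred_forall]
      refine isClosed_biInter fun q _ => isClosed_le continuous_const ?_
      have := hFq q
      fun_prop
    convert isClosedMap_fst_of_compactSpace _ h using 1
    ext s
    simp
  have hsub : {s | ∃ q ∈ paramBox lo hi, F s q = 0}ᶜ ⊆ {s | ∃ w ∈ Metric.sphere (0 : ℂ) 1,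
      ∀ q ∈ paramBox lo hi, 0 ≤ (star w * F s q).re} := by
    intro t ht
    obtain ⟨w, hw, h⟩ := exists_unit_support_of_zero_notMem (K := F t '' paramBox lo hi)
      ((convex_paramBox lo hi).affine_image _)
      ((isCompact_paramBox lo hi).image (AffineMap.continuous_of_finiteDimensional _)) ht
    exact ⟨w, hw, fun q hq => h _ ⟨q, hq, rfl⟩⟩
  rw [frontier_eq_closure_inter_closure] at hs
  obtain ⟨w, hw, h⟩ := hsupp.closure_subset_iff.mpr hsub hs.2
  exact exists_edgeSet_eq_zero_of_support hl (F s) (ne_zero_of_mem_unit_sphere ⟨w, hw⟩) h hsZ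

/-- A preconnected set that meets both a set and its complement meets the frontier. -/
theorem exists_mem_frontier_of_isPreconnected {X : Type*} [TopologicalSpace X] {s t : Set X}
    (hs : IsPreconnected s) (h₁ : (s ∩ t).Nonempty) (h₂ : (s ∩ tᶜ).Nonempty) :
    (s ∩ frontier t).Nonempty := by
  by_contra h
  have hf : ∀ x ∈ s, x ∉ frontier t := fun x hx hxt => h ⟨x, hx, hxt⟩
  have hin : ∀ x ∈ s, x ∈ closure t → x ∈ interior t := fun x hx hxc => by
    by_contra hi
    exact hf x hx ⟨hxc, hi⟩
  obtain ⟨x, hx, hxt⟩ := h₁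
  obtain ⟨y, hy, hyt⟩ := h₂
  obtain ⟨z, -, hz, hz'⟩ := hs (interior t) (closure t)ᶜ isOpen_interior
    isClosed_closure.isOpen_compl
    (fun z hz => (em (z ∈ closure t)).imp (hin z hz) id)
    ⟨x, hx, hin x hx (subset_closure hxt)⟩
    ⟨y, hy, fun hc => hyt (interior_subset (hin y hy hc))⟩
  exact hz' (subset_closure (interior_subset hz))

/-! ### Linear factors of binary forms -/

/-- The zeros of a binary form are a union of lines: through any zero passes a line of zeros. -/
theorem exists_linear_factor (m : ℕ) (a : Fin (m + 1) → ℂ) {x₀ y₀ : ℂ}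
    (h : ∑ k : Fin (m + 1), a k * x₀ ^ (k : ℕ) * y₀ ^ (m - (k : ℕ)) = 0) :
    ∃ u v : ℂ, u * x₀ + v * y₀ = 0 ∧ ∀ x y, u * x + v * y = 0 →
      ∑ k : Fin (m + 1), a k * x ^ (k : ℕ) * y ^ (m - (k : ℕ)) = 0 := by
  have hhom : ∀ t x y : ℂ, ∑ k : Fin (m + 1), a k * (t * x) ^ (k : ℕ) * (t * y) ^ (m - (k : ℕ)) =
      t ^ m * ∑ k : Fin (m + 1), a k * x ^ (k : ℕ) * y ^ (m - (k : ℕ)) := by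
    intro t x y
    rw [Finset.mul_sum]
    refine Finset.sum_congr rfl fun k _ => ?_
    have : t ^ m = t ^ (k : ℕ) * t ^ (m - (k : ℕ)) := by
      rw [← pow_add, Nat.add_sub_cancel' (Nat.lt_succ_iff.mp k.2)]
    rw [this, mul_pow, mul_pow]
    ring
  have hline : ∀ x₁ y₁ : ℂ, (x₁ ≠ 0 ∨ y₁ ≠ 0) →
      ∑ k : Fin (m + 1), a k * x₁ ^ (k : ℕ) * y₁ ^ (m - (k : ℕ)) = 0 →
      ∀ x y, y₁ * x + -x₁ * y = 0 →
        ∑ k : Fin (m + 1), a k * x ^ (k : ℕ) * y ^ (m - (k : ℕ)) = 0 := by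
    intro x₁ y₁ hne h₁ x y hxy
    obtain ⟨t, rfl, rfl⟩ : ∃ t, x = t * x₁ ∧ y = t * y₁ := by
      rcases hne with h | h
      · refine ⟨x / x₁, by field_simp, ?_⟩
        field_simp
        linear_combination -hxy
      · refine ⟨y / y₁, ?_, by field_simp⟩
        field_simp
        linear_combination hxy
    rw [hhom, h₁, mul_zero]
  by_cases h0 : x₀ ≠ 0 ∨ y₀ ≠ 0
  · exact ⟨y₀, -x₀, by ring, hline x₀ y₀ h0 h⟩
  push Not at h0
  obtain ⟨rfl, rfl⟩ := h0
  by_cases hex : ∃ x₁ y₁ : ℂ, (x₁ ≠ 0 ∨ y₁ ≠ 0) ∧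
      ∑ k : Fin (m + 1), a k * x₁ ^ (k : ℕ) * y₁ ^ (m - (k : ℕ)) = 0
  · obtain ⟨x₁, y₁, hne, h₁⟩ := hex
    exact ⟨y₁, -x₁, by ring, hline x₁ y₁ hne h₁⟩
  refine ⟨0, 0, by ring, fun x y _ => ?_⟩
  -- A form vanishing only at the origin would make `P` constant with `m > 0`, so `a_m = 0` and `(1,
  -- 0)` is a zero after all.
  exfalso
  push Not at hex
  set P : ℂ[X] := ∑ k : Fin (m + 1), C (a k) * X ^ (k : ℕ) with hP
  have hroot : ∀ z, ¬ P.IsRoot z := fun z hz => by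
    refine hex z 1 (Or.inr one_ne_zero) ?_
    simpa [hP, eval_finsetSum] using hz
  have hdeg : P.degree = 0 := by
    by_contra hd
    exact (IsAlgClosed.exists_root P hd).elim hroot
  have hcoeff : P.coeff m = a (Fin.last m) := by
    rw [hP, finsetSum_coeff, Finset.sum_eq_single (Fin.last m)]
    · simp
    · intro k _ hk
      have : m ≠ (k : ℕ) := fun e => hk (Fin.ext (by simp [← e]))
      simp [coeff_X_pow, this]
    · simp
  have hm : m ≠ 0 := by
    rintro rfl
    refine hex 1 0 (Or.inl one_ne_zero) ?_
    simpa using h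
  have hlast : a (Fin.last m) = 0 := by
    rw [← hcoeff]
    exact coeff_eq_zero_of_degree_lt (by rw [hdeg]; exact_mod_cast Nat.pos_of_ne_zero hm)
  refine hex 1 0 (Or.inl one_ne_zero) (Finset.sum_eq_zero fun k _ => ?_)
  by_cases hk : k = Fin.last m
  · rw [hk, hlast]; ring
  · have : m - (k : ℕ) ≠ 0 := by
      have := Fin.val_lt_last hk
      omega
    simp [this]

/-! ### Continuity of coefficients and bounds on roots -/

theorem continuous_coeff_mul {Y : Type*} [TopologicalSpace Y] {f g : Y → ℂ[X]}
    (hf : ∀ i, Continuous fun q => (f q).coeff i) (hg : ∀ i, Continuous fun q => (g q).coeff i)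
    (i : ℕ) : Continuous fun q => (f q * g q).coeff i := by
  simp only [coeff_mul]
  exact continuous_finsetSum _ fun x _ => (hf x.1).mul (hg x.2)

theorem continuous_coeff_pow {Y : Type*} [TopologicalSpace Y] {f : Y → ℂ[X]}
    (hf : ∀ i, Continuous fun q => (f q).coeff i) (k i : ℕ) :
    Continuous fun q => (f q ^ k).coeff i := by
  induction k generalizing i with
  | zero => simpa using continuous_const
  | succ k ih => simpa only [pow_succ] using continuous_coeff_mul ih hf i

theorem continuous_coeff_affinePoly {l N : ℕ} (c : Fin (N + 1) → ((Fin l → ℝ) →ᵃ[ℝ] ℂ)) (i : ℕ) :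
    Continuous fun q => (affinePoly N c q).coeff i := by
  simp only [affinePoly, finsetSum_coeff, coeff_C_mul]
  exact continuous_finsetSum _ fun k _ =>
    (AffineMap.continuous_of_finiteDimensional (c k)).mul continuous_const

theorem continuous_coeff_homogComb {Y : Type*} [TopologicalSpace Y] (m : ℕ)
    (a : Fin (m + 1) → ℂ) {f g : Y → ℂ[X]}
    (hf : ∀ i, Continuous fun q => (f q).coeff i) (hg : ∀ i, Continuous fun q => (g q).coeff i)
    (i : ℕ) : Continuous fun q => (homogComb m a (f q) (g q)).coeff i := by
  simp only [homogComb, finsetSum_coeff]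
  exact continuous_finsetSum _ fun k _ => continuous_coeff_mul
    (continuous_coeff_mul (fun _ => continuous_const) (continuous_coeff_pow hf k))
    (continuous_coeff_pow hg _) i

/-- The roots of a compact continuous family of nonzero polynomials of the same degree form a
bounded set. -/
theorem isBounded_roots_of_degree_eq {Y : Type*} [TopologicalSpace Y] {Q : Set Y}
    (hQ : IsCompact Q) {G : Y → ℂ[X]} (hG : ∀ i, Continuous fun q => (G q).coeff i) {N : ℕ}
    (hN : ∀ q ∈ Q, (G q).degree = N) :
    Bornology.IsBounded {s | ∃ q ∈ Q, (G q).IsRoot s} := by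
  have hlead : ∀ q ∈ Q, (G q).coeff N ≠ 0 := fun q hq => coeff_ne_zero_of_eq_degree (hN q hq)
  -- Cauchy's root bound with the maximum weakened to a sum, which is visibly continuous in `q`.
  let B : Y → ℝ := fun q =>
    (∑ i ∈ Finset.range N, ‖(G q).coeff i‖) / ‖(G q).coeff N‖ + 1
  have hB : ContinuousOn B Q := by
    refine ContinuousOn.add (ContinuousOn.div ?_ (hG N).norm.continuousOn
      fun q hq => norm_ne_zero_iff.mpr (hlead q hq)) continuousOn_const
    exact (continuous_finsetSum _ fun i _ => (hG i).norm).continuousOn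
  obtain ⟨M, hM⟩ := hQ.bddAbove_image hB
  refine isBounded_iff_forall_norm_le.mpr ⟨M, ?_⟩
  rintro s ⟨q, hq, hs⟩
  refine le_trans ?_ (hM ⟨q, hq, rfl⟩)
  have hnat : (G q).natDegree = N := natDegree_eq_of_degree_eq_some (hN q hq)
  have h0 : G q ≠ 0 := fun h => hlead q hq (by rw [h, coeff_zero])
  refine (NNReal.coe_le_coe.mpr (hs.norm_lt_cauchyBound h0).le).trans ?_
  have hsup : ((Finset.range N).sup fun i => ‖(G q).coeff i‖₊) ≤
      ∑ i ∈ Finset.range N, ‖(G q).coeff i‖₊ :=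
    Finset.sup_le fun i hi => Finset.single_le_sum (f := fun i => ‖(G q).coeff i‖₊)
      (fun _ _ => zero_le) hi
  have hsup' : (((Finset.range N).sup fun i => ‖(G q).coeff i‖₊ : NNReal) : ℝ) ≤
      ∑ i ∈ Finset.range N, ‖(G q).coeff i‖ := by
    simpa using NNReal.coe_le_coe.mpr hsup
  simp only [cauchyBound, leadingCoeff, hnat, NNReal.coe_add, NNReal.coe_div, NNReal.coe_one,
    coe_nnnorm, B]
  gcongr

/-! ### Evaluation of the family and the edge theorem -/

theorem eval_homogComb (m : ℕ) (a : Fin (m + 1) → ℂ) (n d : ℂ[X]) (s : ℂ) :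
    (homogComb m a n d).eval s =
      ∑ k : Fin (m + 1), a k * n.eval s ^ (k : ℕ) * d.eval s ^ (m - (k : ℕ)) := by
  simp [homogComb, eval_finsetSum]

/-- The value of `affinePoly N c q` at `s`, as an affine function of `q`. -/
noncomputable def affineEval {l : ℕ} (N : ℕ) (c : Fin (N + 1) → ((Fin l → ℝ) →ᵃ[ℝ] ℂ)) (s : ℂ) :
    (Fin l → ℝ) →ᵃ[ℝ] ℂ :=
  ∑ i : Fin (N + 1), s ^ (i : ℕ) • c i

theorem affineEval_apply {l N : ℕ} (c : Fin (N + 1) → ((Fin l → ℝ) →ᵃ[ℝ] ℂ)) (s : ℂ)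
    (q : Fin l → ℝ) : affineEval N c s q = ∑ i : Fin (N + 1), s ^ (i : ℕ) * c i q := by
  have h := map_sum (⟨⟨fun f : (Fin l → ℝ) →ᵃ[ℝ] ℂ => f q, rfl⟩, fun _ _ => rfl⟩ :
    ((Fin l → ℝ) →ᵃ[ℝ] ℂ) →+ ℂ) (fun i : Fin (N + 1) => s ^ (i : ℕ) • c i) Finset.univ
  exact h

theorem eval_affinePoly {l N : ℕ} (c : Fin (N + 1) → ((Fin l → ℝ) →ᵃ[ℝ] ℂ)) (s : ℂ)
    (q : Fin l → ℝ) : (affinePoly N c q).eval s = affineEval N c s q := by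
  rw [affineEval_apply]
  simp only [affinePoly, eval_finsetSum, eval_mul, eval_C, eval_pow, eval_X, mul_comm (c _ q)]

theorem continuous_affineEval {l N : ℕ} (c : Fin (N + 1) → ((Fin l → ℝ) →ᵃ[ℝ] ℂ)) :
    Continuous fun x : ℂ × (Fin l → ℝ) => affineEval N c x.1 x.2 := by
  simp only [affineEval_apply]
  exact continuous_finsetSum _ fun i _ => (continuous_fst.pow _).mul
    ((AffineMap.continuous_of_finiteDimensional (c i)).comp continuous_snd)

theorem theorem3
    -- the box of uncertain parameters, with at least one parameter
    (l : ℕ) (hl : 0 < l) (lo hi : Fin l → ℝ) (hlohi : ∀ i, lo i ≤ hi i)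
    -- the coefficients of `n(s,q)` and `d(s,q)`, affine in `q`
    (n₁ n₂ : ℕ) (c : Fin (n₁ + 1) → ((Fin l → ℝ) →ᵃ[ℝ] ℂ))
    (b : Fin (n₂ + 1) → ((Fin l → ℝ) →ᵃ[ℝ] ℂ))
    -- the coefficients of the form
    (m : ℕ) (a : Fin (m + 1) → ℂ)
    -- the stability region: its complement is connected, and unbounded unless it is empty
    (D : Set ℂ) (hD : IsPreconnected Dᶜ) (hDu : Dᶜ.Nonempty → ¬ Bornology.IsBounded Dᶜ)
    -- the family `{ g(s,q) : q ∈ Q }` has a fixed order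
    (hfix : HasFixedOrder
      ((fun q => homogComb m a (affinePoly n₁ c q) (affinePoly n₂ b q)) '' paramBox lo hi)) :
    FamilyDStable D
        ((fun q => homogComb m a (affinePoly n₁ c q) (affinePoly n₂ b q)) '' paramBox lo hi) ↔
      FamilyDStable D
        ((fun q => homogComb m a (affinePoly n₁ c q) (affinePoly n₂ b q)) '' edgeSet lo hi) := by
  refine ⟨fun h p hp => h p (Set.image_mono (edgeSet_subset_paramBox hlohi) hp), fun hE => ?_⟩
  rintro _ ⟨q₀, hq₀, rfl⟩ s₀ hs₀
  by_contra hs₀D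
  beta_reduce at hs₀
  set G : (Fin l → ℝ) → ℂ[X] := fun q => homogComb m a (affinePoly n₁ c q) (affinePoly n₂ b q)
    with hGdef
  have hcorner : lo ∈ edgeSet lo hi :=
    ⟨⟨0, hl⟩, ⟨le_rfl, hlohi _⟩, fun i _ => Or.inl rfl⟩
  have hcornerQ := edgeSet_subset_paramBox hlohi hcorner
  -- The zero polynomial at a corner would have `s₀ ∉ D` as a root; so the common degree is a
  -- natural number.
  have hG0 : G lo ≠ 0 := fun h => hs₀D (hE _ ⟨lo, hcorner, rfl⟩ s₀ (by
    rw [h]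
    exact eval_zero))
  have hdeg : ∀ q ∈ paramBox lo hi, (G q).degree = ((G lo).natDegree : WithBot ℕ) :=
    fun q hq => (hfix _ ⟨q, hq, rfl⟩ _ ⟨lo, hcornerQ, rfl⟩).trans (degree_eq_natDegree hG0)
  have hbdd := isBounded_roots_of_degree_eq (isCompact_paramBox lo hi)
    (continuous_coeff_homogComb m a (continuous_coeff_affinePoly c)
      (continuous_coeff_affinePoly b)) hdeg
  have hroot : ∀ s q, (G q).IsRoot s ↔ ∑ k : Fin (m + 1),
      a k * affineEval n₁ c s q ^ (k : ℕ) * affineEval n₂ b s q ^ (m - (k : ℕ)) = 0 := by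
    intro s q
    rw [IsRoot.def, hGdef, eval_homogComb, eval_affinePoly, eval_affinePoly]
  obtain ⟨u, v, huv, hfac⟩ := exists_linear_factor m a ((hroot s₀ q₀).mp hs₀)
  let F : ℂ → (Fin l → ℝ) →ᵃ[ℝ] ℂ := fun s => u • affineEval n₁ c s + v • affineEval n₂ b s
  have hFroot : ∀ s q, F s q = 0 → (G q).IsRoot s := fun s q h => (hroot s q).mpr (hfac _ _ h)
  have hFc : Continuous (Function.uncurry fun s q => F s q) :=
    (continuous_const.mul (continuous_affineEval c)).add
      (continuous_const.mul (continuous_affineEval b))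
  have hZ : ¬ Dᶜ ⊆ {s | ∃ q ∈ paramBox lo hi, F s q = 0} := fun h =>
    hDu ⟨s₀, hs₀D⟩ (hbdd.subset (h.trans fun s ⟨q, hq, hs⟩ => ⟨q, hq, hFroot s q hs⟩))
  obtain ⟨t, htD, htZ⟩ := Set.not_subset.mp hZ
  obtain ⟨s, hsD, hs⟩ := exists_mem_frontier_of_isPreconnected hD (t := {s | ∃ q ∈ paramBox lo hi, F s q = 0})
    ⟨s₀, hs₀D, q₀, hq₀, huv⟩ ⟨t, htD, htZ⟩
  obtain ⟨q, hq, hFq⟩ := exists_edgeSet_eq_zero_of_mem_frontier hl hFc hs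
  exact hsD (hE _ ⟨q, hq, rfl⟩ s (hFroot s q hFq))
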